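/- Let $S$ be the semigroup given by the semigroup presentation with generators $a,b,c,d,e,f,x,y$ and defining relations $$cabd=a,\quad eca=a,\quad abf^2=ab,\quad abf=xa,\quad yabf=a,\quad f^3=f,$$ $$ec=ce,\quad ex=xe,\quad ey=ye,\quad cx=xc,\quad cy=yc,\quad xy=yx.$$ For a semigroup $U$, let $U^1$ denote $U$ with an identity adjoined; Green's relations on $U$ are defined by $u\,\mathcal L\,v \iff U^1u=U^1v$, $u\,\mathcal R\,v\iff uU^1=vU^1$, $u\,\mathcal J\,v\iff U^1uU^1=U^1vU^1$, and $\mathcal D=\mathcal L\circ\mathcal R$, that is, $u\,\mathcal D\,v$ if and only if there is $m\in U$ with $u\,\mathcal L\,m$ and $m\,\mathcal R\,v$. Then $T=S\setminus\{f\}$ is a subsemigroup of $S$; it is large, i.e. its complement in $S$ is finite (consisting of the single element $f$). Moreover $\mathcal J=\mathcal D$ in the semigroup $S$, but $\mathcal J\neq\mathcal D$ in the semigroup $T$ (where Green's relations of $T$ are computed in $T$ itself). Thus the property $\mathcal J=\mathcal D$ is not inherited by large subsemigroups, even by those whose complement is a single element. -/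

import Mathlib

namespace SemigroupExample

/-! ### Green's relations

`WithOne S` adjoins a fresh identity to `S` even if `S` already has one; the principal
ideals `S¹ u`, `u S¹` and `S¹ u S¹` below are the same under either convention. -/

section Green

/-- The principal left ideal `S¹ u`. -/
def leftIdeal {S : Type*} [Semigroup S] (u : S) : Set S :=
  {z | ∃ p : WithOne S, (z : WithOne S) = p * (u : WithOne S)}

/-- The principal right ideal `u S¹`. -/
def rightIdeal {S : Type*} [Semigroup S] (u : S) : Set S :=
  {z | ∃ q : WithOne S, (z : WithOne S) = (u : WithOne S) * q}

/-- The principal two-sided ideal `S¹ u S¹`. -/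
def twoSidedIdeal {S : Type*} [Semigroup S] (u : S) : Set S :=
  {z | ∃ p q : WithOne S, (z : WithOne S) = p * (u : WithOne S) * q}

/-- Green's relation `L` on the semigroup `S`. -/
def GreenL (S : Type*) [Semigroup S] (u v : S) : Prop := leftIdeal u = leftIdeal v

/-- Green's relation `R` on the semigroup `S`. -/
def GreenR (S : Type*) [Semigroup S] (u v : S) : Prop := rightIdeal u = rightIdeal v

/-- Green's relation `J` on the semigroup `S`. -/
def GreenJ (S : Type*) [Semigroup S] (u v : S) : Prop := twoSidedIdeal u = twoSidedIdeal v

/-- Green's relation `D = L ∘ R` on the semigroup `S`. -/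
def GreenD (S : Type*) [Semigroup S] (u v : S) : Prop := ∃ m : S, GreenL S u m ∧ GreenR S m v

end Green

/-- A subsemigroup is large if its complement is finite, i.e. if its Rees index
`|S - T| + 1` is finite. -/
def IsLarge {S : Type*} [Semigroup S] (T : Subsemigroup S) : Prop := ((T : Set S)ᶜ).Finite

/-! ### The presented semigroup -/

/-- The generators. -/
inductive Gen : Type
  | a | b | c | d | e | f | x | y
  deriving DecidableEq

section Presentation

open FreeSemigroup Gen

/-- The defining relations, as pairs of words over the generators. -/
inductive Rel : FreeSemigroup Gen → FreeSemigroup Gen → Prop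
  | cabd : Rel (of c * of a * of b * of d) (of a)
  | eca : Rel (of e * of c * of a) (of a)
  | abff : Rel (of a * of b * of f * of f) (of a * of b)
  | abf : Rel (of a * of b * of f) (of x * of a)
  | yabf : Rel (of y * of a * of b * of f) (of a)
  | fff : Rel (of f * of f * of f) (of f)
  | ec : Rel (of e * of c) (of c * of e)
  | ex : Rel (of e * of x) (of x * of e)
  | ey : Rel (of e * of y) (of y * of e)
  | cx : Rel (of c * of x) (of x * of c)
  | cy : Rel (of c * of y) (of y * of c)
  | xy : Rel (of x * of y) (of y * of x)

end Presentation

/-- The semigroup presented by the generators `Gen` and the relations `Rel`: the quotient of the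
free semigroup by the congruence generated by `Rel`. -/
abbrev S : Type := (conGen Rel).Quotient

/-- The element of `S` represented by a generator. -/
def gen (g : Gen) : S := (FreeSemigroup.of g : FreeSemigroup Gen)

end SemigroupExample

/-!
In `S` one has `af² = a`, `ab = xaf` and `afd = eya`, and in front of a letter `a` the commuting
letters `c`, `e` and `x`, `y` are two pairs of mutually inverse elements. Let `u = p u q` in `S¹`.
Counting letters `a`, neither `p` nor `q` contains one. A left action of `S` on the naturals (with a
point added), in which all letters but `f` increase the state, shows that `p` is a power of `f`
unless `p` and everything in `u` before its first `a` are products of the letters `c`, `e`, `x`,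
`y`; in both cases multiplication by `p` can be undone on `u`. A right action, in which the letters
`b` and `d` absorbed by an `a` increase an integer potential, shows that `q` is a power of `f`
unless `u = z a fᵗ` with `z` a product of `c`, `e`, `x`, `y`. Any two elements of the latter form
are `D`-related, and `J = D` in `S` follows.

In `S ∖ {f}` the elements `a = (cx)(af)d` and `af = y a b` are `J`-related. If `a L m R af`, then
the potential cannot increase along the multiplications `af ↦ m ↦ af` on the right, so that
`af = m r` forces `r` to be a power of `f`, and parity leaves only `r = f`, the missing element.
-/

namespace SemigroupExample

open Gen

section Green

variable {U : Type*} [Semigroup U] {u v w : U}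

lemma leftIdeal_subset_iff : leftIdeal u ⊆ leftIdeal v ↔ u ∈ leftIdeal v :=
  ⟨fun h => h ⟨1, (one_mul _).symm⟩,
    fun ⟨p, hp⟩ _ ⟨r, hr⟩ => ⟨r * p, by rw [hr, hp, mul_assoc]⟩⟩

lemma rightIdeal_subset_iff : rightIdeal u ⊆ rightIdeal v ↔ u ∈ rightIdeal v :=
  ⟨fun h => h ⟨1, (mul_one _).symm⟩,
    fun ⟨q, hq⟩ _ ⟨r, hr⟩ => ⟨q * r, by rw [hr, hq, mul_assoc]⟩⟩

lemma twoSidedIdeal_subset_iff : twoSidedIdeal u ⊆ twoSidedIdeal v ↔ u ∈ twoSidedIdeal v :=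
  ⟨fun h => h ⟨1, 1, by rw [one_mul, mul_one]⟩,
    fun ⟨p, q, hu⟩ _ ⟨r, s, hz⟩ => ⟨r * p, q * s, by rw [hz, hu]; simp only [mul_assoc]⟩⟩

lemma greenL_iff : GreenL U u v ↔ u ∈ leftIdeal v ∧ v ∈ leftIdeal u :=
  Set.Subset.antisymm_iff.trans (and_congr leftIdeal_subset_iff leftIdeal_subset_iff)

lemma greenR_iff : GreenR U u v ↔ u ∈ rightIdeal v ∧ v ∈ rightIdeal u :=
  Set.Subset.antisymm_iff.trans (and_congr rightIdeal_subset_iff rightIdeal_subset_iff)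

lemma greenJ_iff : GreenJ U u v ↔ u ∈ twoSidedIdeal v ∧ v ∈ twoSidedIdeal u :=
  Set.Subset.antisymm_iff.trans (and_congr twoSidedIdeal_subset_iff twoSidedIdeal_subset_iff)

lemma twoSidedIdeal_trans (huv : u ∈ twoSidedIdeal v) (hvw : v ∈ twoSidedIdeal w) :
    u ∈ twoSidedIdeal w :=
  twoSidedIdeal_subset_iff.2 hvw huv

lemma mem_twoSidedIdeal_of_mem_leftIdeal (h : u ∈ leftIdeal v) : u ∈ twoSidedIdeal v := by
  obtain ⟨p, hp⟩ := h
  exact ⟨p, 1, by rw [hp, mul_one]⟩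

lemma mem_twoSidedIdeal_of_mem_rightIdeal (h : u ∈ rightIdeal v) : u ∈ twoSidedIdeal v := by
  obtain ⟨q, hq⟩ := h
  exact ⟨1, q, by rw [hq, one_mul]⟩

lemma mul_mul_mem_twoSidedIdeal (u v w : U) : u * v * w ∈ twoSidedIdeal v :=
  ⟨u, w, rfl⟩

lemma exists_coe_eq_mul (p : WithOne U) (u : U) : ∃ m : U, (m : WithOne U) = p * u := by
  cases p with
  | one => exact ⟨u, (one_mul _).symm⟩
  | coe p => exact ⟨p * u, rfl⟩

lemma GreenR.greenD (h : GreenR U u v) : GreenD U u v :=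
  ⟨u, rfl, h⟩

lemma GreenL.trans_greenD (huv : GreenL U u v) (hvw : GreenD U v w) : GreenD U u w := by
  obtain ⟨m, hL, hR⟩ := hvw
  exact ⟨m, Eq.trans huv hL, hR⟩

lemma GreenD.greenJ (h : GreenD U u v) : GreenJ U u v := by
  obtain ⟨m, hL, hR⟩ := h
  obtain ⟨hum, hmu⟩ := greenL_iff.1 hL
  obtain ⟨hmv, hvm⟩ := greenR_iff.1 hR
  exact greenJ_iff.2
    ⟨twoSidedIdeal_trans (mem_twoSidedIdeal_of_mem_leftIdeal hum)
        (mem_twoSidedIdeal_of_mem_rightIdeal hmv),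
      twoSidedIdeal_trans (mem_twoSidedIdeal_of_mem_rightIdeal hvm)
        (mem_twoSidedIdeal_of_mem_leftIdeal hmu)⟩

lemma greenJ_eq_greenD_of_one_sided
    (left : ∀ u v : U, v ∈ leftIdeal u → u ∈ twoSidedIdeal v → GreenL U u v)
    (right : ∀ u v : U, v ∈ rightIdeal u → u ∈ twoSidedIdeal v → GreenD U u v) :
    GreenJ U = GreenD U := by
  funext u v
  refine propext ⟨fun h => ?_, GreenD.greenJ⟩
  obtain ⟨huv, ⟨p, q, hv⟩⟩ := greenJ_iff.1 h
  obtain ⟨m, hm⟩ := exists_coe_eq_mul p u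
  have hmu : m ∈ leftIdeal u := ⟨p, hm⟩
  have hvm : v ∈ rightIdeal m := ⟨q, by rw [hv, hm]⟩
  have hum : u ∈ twoSidedIdeal m :=
    twoSidedIdeal_trans huv (mem_twoSidedIdeal_of_mem_rightIdeal hvm)
  have hmv : m ∈ twoSidedIdeal v :=
    twoSidedIdeal_trans (mem_twoSidedIdeal_of_mem_leftIdeal hmu) huv
  exact (left u m hmu hum).trans_greenD (right m v hvm hmv)

end Green

section Presented

variable {α : Type*} {r : FreeSemigroup α → FreeSemigroup α → Prop}

/-- The extension to `U¹` of a monoid-valued assignment on the generators of a presented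
semigroup `U` that respects the relations. -/
def presentedLift {M : Type*} [Monoid M] (φ : α → M)
    (h : ∀ u v, r u v → FreeSemigroup.lift φ u = FreeSemigroup.lift φ v) :
    WithOne (conGen r).Quotient →* M :=
  WithOne.lift
    { toFun := fun s => Con.liftOn s (FreeSemigroup.lift φ) fun _ _ huv =>
        (Con.conGen_le (c := Con.ker (FreeSemigroup.lift φ))).2 h huv
      map_mul' := fun s t => by
        induction s, t using Con.induction_on₂ with
        | H s t => exact map_mul (FreeSemigroup.lift φ) s t }

lemma presented_induction {P : WithOne (conGen r).Quotient → Prop} (one : P 1)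
    (of_mul : ∀ g p, P p → P ((((FreeSemigroup.of g : FreeSemigroup α) :
      (conGen r).Quotient) : WithOne (conGen r).Quotient) * p)) (p) : P p := by
  cases p with
  | one => exact one
  | coe u =>
    induction u using Con.induction_on with
    | H w =>
      induction w using FreeSemigroup.recOnMul with
      | ih1 g => simpa only [mul_one] using of_mul g 1 one
      | ih2 g w _ hw => exact of_mul g _ hw

end Presented

local notation "γ" g:max => ((gen g : S) : WithOne S)

lemma gen_induction {P : WithOne S → Prop} (one : P 1) (gen_mul : ∀ g p, P p → P (γ g * p))
    (p : WithOne S) : P p :=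
  presented_induction one gen_mul p

section Relations

lemma coe_eq_coe_of_rel {u v : FreeSemigroup Gen} (h : Rel u v) :
    ((u : S) : WithOne S) = ((v : S) : WithOne S) :=
  congrArg _ ((Con.eq _).2 (ConGen.Rel.of _ _ h))

lemma cabd_eq_a : γ c * γ a * γ b * γ d = γ a := coe_eq_coe_of_rel Rel.cabd
lemma eca_eq_a : γ e * γ c * γ a = γ a := coe_eq_coe_of_rel Rel.eca
lemma abff_eq_ab : γ a * γ b * γ f * γ f = γ a * γ b := coe_eq_coe_of_rel Rel.abff
lemma abf_eq_xa : γ a * γ b * γ f = γ x * γ a := coe_eq_coe_of_rel Rel.abf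
lemma yabf_eq_a : γ y * γ a * γ b * γ f = γ a := coe_eq_coe_of_rel Rel.yabf
lemma fff_eq_f : γ f * γ f * γ f = γ f := coe_eq_coe_of_rel Rel.fff
lemma ec_eq_ce : γ e * γ c = γ c * γ e := coe_eq_coe_of_rel Rel.ec
lemma ex_eq_xe : γ e * γ x = γ x * γ e := coe_eq_coe_of_rel Rel.ex
lemma ey_eq_ye : γ e * γ y = γ y * γ e := coe_eq_coe_of_rel Rel.ey
lemma cx_eq_xc : γ c * γ x = γ x * γ c := coe_eq_coe_of_rel Rel.cx
lemma cy_eq_yc : γ c * γ y = γ y * γ c := coe_eq_coe_of_rel Rel.cy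
lemma xy_eq_yx : γ x * γ y = γ y * γ x := coe_eq_coe_of_rel Rel.xy

lemma yxa_eq_a : γ y * γ x * γ a = γ a := by
  rw [mul_assoc, ← abf_eq_xa, ← mul_assoc, ← mul_assoc, yabf_eq_a]

lemma xaf_eq_ab : γ x * γ a * γ f = γ a * γ b := by
  rw [← abf_eq_xa, abff_eq_ab]

lemma aff_eq_a : γ a * γ f * γ f = γ a := by
  calc γ a * γ f * γ f = γ y * (γ x * γ a * γ f) * γ f := by
        conv_lhs => rw [← yxa_eq_a]
        simp only [mul_assoc]
    _ = γ y * (γ a * γ b * γ f) := by rw [xaf_eq_ab]; simp only [mul_assoc]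
    _ = γ a := by rw [abf_eq_xa, ← mul_assoc, yxa_eq_a]

lemma af_eq_yab : γ a * γ f = γ y * γ a * γ b := by
  rw [mul_assoc, ← xaf_eq_ab, ← mul_assoc, ← mul_assoc, yxa_eq_a]

lemma cxafd_eq_a : γ c * γ x * (γ a * γ f) * γ d = γ a := by
  calc γ c * γ x * (γ a * γ f) * γ d = γ c * (γ x * γ a * γ f) * γ d := by
        simp only [mul_assoc]
    _ = γ a := by rw [xaf_eq_ab, ← mul_assoc, cabd_eq_a]

lemma afd_eq_eya : γ a * γ f * γ d = γ e * γ y * γ a := by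
  calc γ a * γ f * γ d = γ e * γ c * (γ y * γ x * γ a) * γ f * γ d := by
        rw [yxa_eq_a, eca_eq_a]
    _ = γ e * (γ c * γ y) * γ x * γ a * γ f * γ d := by simp only [mul_assoc]
    _ = γ e * γ y * (γ c * γ x * (γ a * γ f) * γ d) := by
        rw [cy_eq_yc]; simp only [mul_assoc]
    _ = γ e * γ y * γ a := by rw [cxafd_eq_a]

lemma a_mul_f_pow_two_mul (n : ℕ) : γ a * γ f ^ (2 * n) = γ a := by
  induction n with
  | zero => rw [mul_zero, pow_zero, mul_one]
  | succ n ih => rw [mul_add, mul_one, pow_add, ← mul_assoc, ih, pow_two, ← mul_assoc, aff_eq_a]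

lemma a_mul_f_pow_mul_f_pow_add (m n : ℕ) :
    γ a * γ f ^ m * γ f ^ (m + n) = γ a * γ f ^ n := by
  rw [mul_assoc, ← pow_add, ← add_assoc, ← two_mul, pow_add, ← mul_assoc, a_mul_f_pow_two_mul]

end Relations

section Counting

/-- The number of letters `a`. -/
def countA (p : WithOne S) : ℕ :=
  (presentedLift (M := Multiplicative ℕ) (fun g => .ofAdd (if g = a then 1 else 0))
    (by intro u v h; cases h <;> rfl) p).toAdd

@[simp] lemma countA_mul (p q : WithOne S) : countA (p * q) = countA p + countA q := by
  simp only [countA, map_mul, toAdd_mul]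

@[simp] lemma countA_gen (g : Gen) : countA (γ g) = if g = a then 1 else 0 := rfl

/-- The number of letters other than `f`, where a letter `a` counts as infinitely many. -/
def nonF (p : WithOne S) : ℕ∞ :=
  (presentedLift (M := Multiplicative ℕ∞)
    (fun g => .ofAdd (if g = a then ⊤ else if g = f then 0 else 1))
    (by intro u v h; cases h <;> rfl) p).toAdd

@[simp] lemma nonF_one : nonF 1 = 0 := rfl

@[simp] lemma nonF_mul (p q : WithOne S) : nonF (p * q) = nonF p + nonF q := by
  simp only [nonF, map_mul, toAdd_mul]

@[simp] lemma nonF_gen (g : Gen) :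
    nonF (γ g) = if g = a then ⊤ else if g = f then 0 else 1 := rfl

lemma exists_nonF_eq_natCast {p : WithOne S} (hp : countA p = 0) : ∃ n : ℕ, nonF p = n := by
  induction p using gen_induction with
  | one => exact ⟨0, rfl⟩
  | gen_mul g p ih =>
    rw [countA_mul, Nat.add_eq_zero_iff] at hp
    obtain ⟨n, hn⟩ := ih hp.2
    have hg : g ≠ a := fun hg => by simp [hg] at hp
    rw [nonF_mul, hn, nonF_gen, if_neg hg]
    split_ifs
    · exact ⟨n, zero_add _⟩
    · exact ⟨1 + n, by push_cast; rfl⟩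

lemma nonF_induction {P : WithOne S → ℕ → Prop} (one : P 1 0)
    (f_mul : ∀ p n, P p n → P (γ f * p) n)
    (gen_mul : ∀ g p n, g ≠ a → g ≠ f → nonF p = (n : ℕ) → P p n →
      P (γ g * p) (n + 1))
    (p : WithOne S) {n : ℕ} (hp : nonF p = n) : P p n := by
  induction p using gen_induction generalizing n with
  | one =>
    obtain rfl : 0 = n := by
      rw [nonF_one] at hp
      exact_mod_cast hp
    exact one
  | gen_mul g p ih =>
    have hg : g ≠ a := by
      rintro rfl
      simp at hp
    rw [nonF_mul, nonF_gen, if_neg hg] at hp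
    split_ifs at hp with hf
    · rw [hf]
      exact f_mul p n (ih ((zero_add _).symm.trans hp))
    · obtain ⟨m, hm⟩ : ∃ m : ℕ, nonF p = m :=
        ENat.ne_top_iff_exists.1 (fun h => by simp [h] at hp) |>.imp fun _ => Eq.symm
      obtain rfl : m + 1 = n := by
        rw [hm, add_comm] at hp
        exact_mod_cast hp
      exact gen_mul g p m hg hf hm (ih hm)

lemma eq_f_pow_of_nonF_eq_zero {p : WithOne S} (hp : nonF p = 0) :
    p = 1 ∨ p = γ f ∨ p = γ f * γ f := by
  refine nonF_induction (P := fun p n => n = 0 → p = 1 ∨ p = γ f ∨ p = γ f * γ f)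
    (fun _ => .inl rfl) (fun p n ih hn => ?_) (fun _ _ _ _ _ _ _ h => by omega) p hp rfl
  rcases ih hn with rfl | rfl | rfl
  · exact .inr (.inl (mul_one _))
  · exact .inr (.inr rfl)
  · exact .inr (.inl (by rw [← mul_assoc, fff_eq_f]))

lemma mul_mul_eq_self_of_nonF_eq_zero {p : WithOne S} (hp : nonF p = 0) :
    p * p * p = p := by
  rcases eq_f_pow_of_nonF_eq_zero hp with rfl | rfl | rfl
  · rw [mul_one, mul_one]
  · exact fff_eq_f
  · calc γ f * γ f * (γ f * γ f) * (γ f * γ f)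
        = γ f * γ f * γ f * (γ f * γ f * γ f) := by simp only [mul_assoc]
      _ = γ f * γ f := by rw [fff_eq_f]

end Counting

section Actions

/-- The states of an automaton reading words in the generators from left to right. The potential of
a product of letters `c`, `e`, `x`, `y` counts them as `-2`, `2`, `1`, `-1`, so that the relations
`ab = xaf` and `afd = eya` trade a letter `b` or `d` for one unit of potential.
* `live h t`: the word ends in a factor equal to `z a fᵗ`, with `z` of potential `h`.
* `pend k h`: there is no `a` in the word, or a letter after the last `a` could not be absorbed by
  such a factor; from there on `k` letters other than `f` have been read, and the word ends in a
  block of letters `c`, `e`, `x`, `y` of potential `h`. -/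
inductive State : Type
  | pend (k : ℕ) (h : ℤ)
  | live (h : ℤ) (t : Bool)

open State

/-- The transition function of the right action of `S¹` on `State`. -/
def stepRight : State → Gen → State
  | pend _ h, a => live h false
  | pend k _, b => pend (k + 1) 0
  | pend k h, c => pend (k + 1) (h - 2)
  | pend k _, d => pend (k + 1) 0
  | pend k h, e => pend (k + 1) (h + 2)
  | pend k _, f => pend k 0
  | pend k h, x => pend (k + 1) (h + 1)
  | pend k h, y => pend (k + 1) (h - 1)
  | live _ _, a => live 0 false
  | live h false, b => live (h + 1) true
  | live h true, d => live (h + 1) false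
  | live h t, f => live h !t
  | live _ true, b => pend 1 0
  | live _ false, d => pend 1 0
  | live _ _, c => pend 1 (-2)
  | live _ _, e => pend 1 2
  | live _ _, x => pend 1 1
  | live _ _, y => pend 1 (-1)

lemma lift_stepRight_eq_of_rel {u v : FreeSemigroup Gen} (h : Rel u v) :
    FreeSemigroup.lift (fun g => (.op fun s => stepRight s g : (Function.End State)ᵐᵒᵖ)) u =
      FreeSemigroup.lift (fun g => (.op fun s => stepRight s g : (Function.End State)ᵐᵒᵖ)) v := by
  set φ : Gen → (Function.End State)ᵐᵒᵖ := fun g => .op fun s => stepRight s g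
  have lift_mul_of (w : FreeSemigroup Gen) (g : Gen) (s : State) :
      (FreeSemigroup.lift φ (w * .of g)).unop s =
        stepRight ((FreeSemigroup.lift φ w).unop s) g := by
    rw [map_mul]
    rfl
  have lift_of (g : Gen) (s : State) :
      (FreeSemigroup.lift φ (.of g)).unop s = stepRight s g := rfl
  refine MulOpposite.unop_injective (funext fun s => ?_)
  cases h <;> rcases s with _ | ⟨_, _ | _⟩ <;> simp only [lift_mul_of, lift_of, stepRight] <;>
    grind

/-- The right action of `S¹` on `State`: the state reached from `s` by reading `p`. -/
def runRight (s : State) (p : WithOne S) : State :=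
  (presentedLift (M := (Function.End State)ᵐᵒᵖ) (fun g => .op fun s => stepRight s g)
    (fun _ _ => lift_stepRight_eq_of_rel) p).unop s

@[simp] lemma runRight_one (s : State) : runRight s 1 = s := rfl

@[simp] lemma runRight_mul (s : State) (p q : WithOne S) :
    runRight s (p * q) = runRight (runRight s p) q := by
  simp only [runRight, map_mul, MulOpposite.unop_mul]
  rfl

@[simp] lemma runRight_gen (s : State) (g : Gen) : runRight s (γ g) = stepRight s g := rfl

/-- The transition function of a left action of `S¹`, for reading words from right to left. It
counts the letters other than `f` in the part of the word before the first `a`, from the beginning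
up to the last letter `b`, `d` or `f` of that part; `none` means that there is no such letter. -/
def stepLeft : Gen → Option ℕ → Option ℕ
  | a, _ => none
  | b, o | d, o => some (o.getD 0 + 1)
  | f, o => some (o.getD 0)
  | c, o | e, o | x, o | y, o => o.map (· + 1)

/-- The left action of `S¹` given by `stepLeft`. -/
def runLeft (p : WithOne S) (o : Option ℕ) : Option ℕ :=
  presentedLift (M := Function.End (Option ℕ)) stepLeft
    (by intro u v h; funext o; cases h <;> cases o <;> rfl) p o

@[simp] lemma runLeft_mul (p q : WithOne S) (o : Option ℕ) :
    runLeft (p * q) o = runLeft p (runLeft q o) := by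
  simp only [runLeft, map_mul]
  rfl

lemma runRight_pend {p : WithOne S} {n : ℕ} (hp : nonF p = n) (k : ℕ) (h : ℤ) :
    ∃ h', runRight (pend k h) p = pend (k + n) h' := by
  refine nonF_induction (P := fun p n => ∀ k h, ∃ h', runRight (pend k h) p = pend (k + n) h')
    (fun k h => ⟨h, rfl⟩) (fun p n ih k h => ?_) (fun g p n hga hgf _ ih k h => ?_) p hp k h
  · rw [runRight_mul]
    exact ih k 0
  · obtain ⟨h₁, hg⟩ : ∃ h₁, runRight (pend k h) (γ g) = pend (k + 1) h₁ := by
      cases g <;> first | contradiction | exact ⟨_, rfl⟩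
    rw [runRight_mul, hg, add_comm n, ← add_assoc]
    exact ih (k + 1) h₁

lemma stepRight_live {g : Gen} (hga : g ≠ a) (hgf : g ≠ f) (h : ℤ) (t : Bool) :
    (∃ t', stepRight (live h t) g = live (h + 1) t') ∨
      ∃ h', stepRight (live h t) g = pend 1 h' := by
  cases g <;> cases t <;>
    first | contradiction | exact .inl ⟨_, rfl⟩ | exact .inr ⟨_, rfl⟩

lemma potential_eq_of_runRight_live {p : WithOne S} {n : ℕ} (hp : nonF p = n) {h h' : ℤ}
    {t t' : Bool} (hrun : runRight (live h t) p = live h' t') : h' = h + n := by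
  refine nonF_induction (P := fun p n => ∀ h t, runRight (live h t) p = live h' t' → h' = h + n)
    (fun h t hrun => ?_) (fun p n ih h t hrun => ?_) (fun g p n hga hgf hp ih h t hrun => ?_)
    p hp h t hrun
  · rw [runRight_one, live.injEq] at hrun
    rw [← hrun.1, Nat.cast_zero, add_zero]
  · rw [runRight_mul] at hrun
    exact ih h (!t) hrun
  · rw [runRight_mul] at hrun
    rcases stepRight_live hga hgf h t with ⟨t₁, hg⟩ | ⟨h₁, hg⟩ <;> rw [runRight_gen, hg] at hrun
    · rw [ih _ _ hrun]
      push_cast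
      ring
    · obtain ⟨h₂, hrun'⟩ := runRight_pend hp 1 h₁
      rw [hrun'] at hrun
      cases hrun

lemma exists_runRight_mul_a {p : WithOne S} (hp : countA p = 0) (k : ℕ) (h : ℤ) :
    ∃ h', runRight (pend k h) (p * γ a) = live h' false := by
  obtain ⟨n, hn⟩ := exists_nonF_eq_natCast hp
  obtain ⟨h', hrun⟩ := runRight_pend hn k h
  exact ⟨h', by rw [runRight_mul, hrun]; rfl⟩

lemma nonF_eq_zero_of_runRight_eq_self {p : WithOne S} (hp : countA p = 0) {s : State}
    (hs : runRight s p = s) : nonF p = 0 := by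
  obtain ⟨n, hn⟩ := exists_nonF_eq_natCast hp
  suffices n = 0 by rw [hn, this, Nat.cast_zero]
  cases s with
  | pend k h =>
    obtain ⟨h', hrun⟩ := runRight_pend hn k h
    rw [hrun, State.pend.injEq] at hs
    omega
  | live h t =>
    have := potential_eq_of_runRight_live hn hs
    omega

lemma runRight_pend_zero {p : WithOne S} (hp : nonF p = 0) :
    runRight (pend 0 0) p = pend 0 0 := by
  rcases eq_f_pow_of_nonF_eq_zero hp with rfl | rfl | rfl <;> rfl

lemma runLeft_some {p : WithOne S} {n : ℕ} (hp : nonF p = n) (k : ℕ) :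
    runLeft p (some k) = some (k + n) := by
  refine nonF_induction (P := fun p n => runLeft p (some k) = some (k + n)) rfl
    (fun p n ih => ?_) (fun g p n hga hgf _ ih => ?_) p hp
  · rw [runLeft_mul, ih]
    rfl
  · rw [runLeft_mul, ih]
    cases g <;> first | contradiction | rfl

lemma runLeft_congr {p : WithOne S} (hp : countA p ≠ 0) (o o' : Option ℕ) :
    runLeft p o = runLeft p o' := by
  induction p using gen_induction with
  | one => exact absurd rfl hp
  | gen_mul g p ih =>
    rw [runLeft_mul, runLeft_mul]
    by_cases hg : g = a
    · rw [hg]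
      rfl
    · rw [ih (by simpa [hg] using hp)]

end Actions

section CommutingLetters

/-- The submonoid of `S¹` generated by the four commuting letters `c`, `e`, `x` and `y`. -/
def cexy : Submonoid (WithOne S) :=
  Submonoid.closure {γ c, γ e, γ x, γ y}

lemma c_mem_cexy : γ c ∈ cexy := Submonoid.subset_closure (by simp)
lemma e_mem_cexy : γ e ∈ cexy := Submonoid.subset_closure (by simp)
lemma x_mem_cexy : γ x ∈ cexy := Submonoid.subset_closure (by simp)
lemma y_mem_cexy : γ y ∈ cexy := Submonoid.subset_closure (by simp)

lemma commute_of_mem_cexy {z z' : WithOne S} (hz : z ∈ cexy) (hz' : z' ∈ cexy) :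
    Commute z z' := by
  have : IsMulCommutative cexy := by
    refine Submonoid.isMulCommutative_closure _ ?_
    rintro _ (rfl | rfl | rfl | rfl) _ (rfl | rfl | rfl | rfl) <;>
      simp only [ec_eq_ce, ex_eq_xe, ey_eq_ye, cx_eq_xc, cy_eq_yc, xy_eq_yx]
  exact congrArg Subtype.val (mul_comm' (⟨z, hz⟩ : cexy) ⟨z', hz'⟩)

lemma countA_eq_zero_of_mem_cexy {z : WithOne S} (hz : z ∈ cexy) : countA z = 0 := by
  induction hz using Submonoid.closure_induction with
  | mem z hz => rcases hz with rfl | rfl | rfl | rfl <;> rfl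
  | one => rfl
  | mul z z' _ _ hz hz' => rw [countA_mul, hz, hz']

lemma exists_mul_mul_a_eq_a {z : WithOne S} (hz : z ∈ cexy) :
    ∃ r ∈ cexy, r * z * γ a = γ a := by
  induction hz using Submonoid.closure_induction with
  | mem z hz =>
    rcases hz with rfl | rfl | rfl | rfl
    · exact ⟨γ e, e_mem_cexy, eca_eq_a⟩
    · exact ⟨γ c, c_mem_cexy, ec_eq_ce ▸ eca_eq_a⟩
    · exact ⟨γ y, y_mem_cexy, yxa_eq_a⟩
    · exact ⟨γ x, x_mem_cexy, xy_eq_yx ▸ yxa_eq_a⟩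
  | one => exact ⟨1, one_mem _, by rw [mul_one, one_mul]⟩
  | mul z z' hz _ ih ih' =>
    obtain ⟨r, hr, hrz⟩ := ih
    obtain ⟨r', hr', hrz'⟩ := ih'
    refine ⟨r * r', mul_mem hr hr', ?_⟩
    calc r * r' * (z * z') * γ a = r * (r' * z) * z' * γ a := by simp only [mul_assoc]
      _ = r * z * (r' * z' * γ a) := by
        rw [commute_of_mem_cexy hr' hz]; simp only [mul_assoc]
      _ = γ a := by rw [hrz', hrz]

lemma eq_mul_a_mul_of_runLeft_eq_none {w : WithOne S} (hw : runLeft w none = none) :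
    w ∈ cexy ∨ ∃ z ∈ cexy, ∃ w', w = z * γ a * w' := by
  induction w using gen_induction with
  | one => exact .inl (one_mem _)
  | gen_mul g w ih =>
    rw [runLeft_mul] at hw
    by_cases hga : g = a
    · exact .inr ⟨1, one_mem _, w, by rw [hga, one_mul]⟩
    obtain ⟨hg, hw'⟩ : γ g ∈ cexy ∧ runLeft w none = none := by
      cases g with
      | a => contradiction
      | b | d | f => cases hw
      | c => exact ⟨c_mem_cexy, Option.map_eq_none_iff.1 hw⟩
      | e => exact ⟨e_mem_cexy, Option.map_eq_none_iff.1 hw⟩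
      | x => exact ⟨x_mem_cexy, Option.map_eq_none_iff.1 hw⟩
      | y => exact ⟨y_mem_cexy, Option.map_eq_none_iff.1 hw⟩
    rcases ih hw' with hw | ⟨z, hz, w', rfl⟩
    · exact .inl (mul_mem hg hw)
    · exact .inr ⟨γ g * z, mul_mem hg hz, w', by simp only [mul_assoc]⟩

end CommutingLetters

section Dichotomies

open State

variable {u p q : WithOne S}

lemma countA_eq_zero_of_eq_mul_mul (h : u = p * u * q) : countA p = 0 ∧ countA q = 0 := by
  have := congrArg countA h
  rw [countA_mul, countA_mul] at this
  omega

lemma nonF_eq_zero_of_eq_mul_mul (hu : countA u = 0) (h : u = p * u * q) :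
    nonF p = 0 ∧ nonF q = 0 := by
  obtain ⟨hp, hq⟩ := countA_eq_zero_of_eq_mul_mul h
  obtain ⟨k, hk⟩ := exists_nonF_eq_natCast hu
  obtain ⟨m, hm⟩ := exists_nonF_eq_natCast hp
  obtain ⟨n, hn⟩ := exists_nonF_eq_natCast hq
  have := congrArg nonF h
  rw [nonF_mul, nonF_mul, hk, hm, hn] at this
  norm_cast at this
  rw [hm, hn]
  norm_cast
  omega

lemma nonF_left_eq_zero_or (h : u = p * u * q) :
    nonF p = 0 ∨ p ∈ cexy ∧ ∃ z ∈ cexy, ∃ w, u = z * γ a * w := by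
  by_cases hu : countA u = 0
  · exact .inl (nonF_eq_zero_of_eq_mul_mul hu h).1
  have hp := (countA_eq_zero_of_eq_mul_mul h).1
  obtain ⟨n, hn⟩ := exists_nonF_eq_natCast hp
  have hfix : runLeft p (runLeft u none) = runLeft u none := by
    conv_rhs => rw [h, runLeft_mul, runLeft_mul, runLeft_congr hu _ none]
  cases ho : runLeft u none with
  | some k =>
    rw [ho, runLeft_some hn, Option.some.injEq] at hfix
    refine .inl ?_
    rw [hn, Nat.cast_eq_zero]
    omega
  | none =>
    rw [ho] at hfix
    refine .inr ⟨?_, ?_⟩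
    · refine (eq_mul_a_mul_of_runLeft_eq_none hfix).resolve_right ?_
      rintro ⟨z, -, w, rfl⟩
      simp at hp
    · exact (eq_mul_a_mul_of_runLeft_eq_none ho).resolve_left
        fun hu' => hu (countA_eq_zero_of_mem_cexy hu')

lemma exists_mul_mul_eq_self (h : u = p * u * q) : ∃ s, s * p * u = u := by
  rcases nonF_left_eq_zero_or h with hp | ⟨hp, z, hz, w, rfl⟩
  · refine ⟨p, ?_⟩
    calc p * p * u = p * p * p * u * q := by conv_lhs => rw [h]; simp only [← mul_assoc]
      _ = p * u * q := by rw [mul_mul_eq_self_of_nonF_eq_zero hp]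
      _ = u := h.symm
  · obtain ⟨r, hr, hrp⟩ := exists_mul_mul_a_eq_a hp
    refine ⟨r, ?_⟩
    calc r * p * (z * γ a * w) = r * p * z * γ a * w := by simp only [mul_assoc]
      _ = z * (r * p * γ a) * w := by
        rw [commute_of_mem_cexy (mul_mem hr hp) hz]; simp only [mul_assoc]
      _ = z * γ a * w := by rw [hrp]

/-- The elements of `S¹` of the form `z a fᵗ` with `z` in `cexy` and `t ∈ {0, 1}`. Any two of
them that lie in `S` are `D`-related. -/
def aClass : Set (WithOne S) :=
  {u | ∃ z ∈ cexy, ∃ t : Bool, u = z * γ a * γ f ^ t.toNat}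

lemma mul_mem_aClass {z : WithOne S} (hz : z ∈ cexy) (hu : u ∈ aClass) : z * u ∈ aClass := by
  obtain ⟨z', hz', t, rfl⟩ := hu
  exact ⟨z * z', mul_mem hz hz', t, by simp only [mul_assoc]⟩

/-- A letter that cannot be absorbed makes the automaton forget the potential `h`. -/
lemma a_mul_gen_mem_aClass_or (g : Gen) (t : Bool) :
    (∃ z ∈ cexy, ∃ (t' : Bool) (k : ℤ),
        γ a * γ f ^ t.toNat * γ g = z * γ a * γ f ^ t'.toNat ∧
          ∀ h, stepRight (live h t) g = live (h + k) t') ∨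
      ∃ s, ∀ h, stepRight (live h t) g = s := by
  cases g <;> cases t
  case b.false =>
    refine .inl ⟨γ x, x_mem_cexy, true, 1, ?_, fun _ => rfl⟩
    simp [xaf_eq_ab]
  case d.true =>
    refine .inl ⟨γ e * γ y, mul_mem e_mem_cexy y_mem_cexy, false, 1, ?_, fun _ => rfl⟩
    simp [afd_eq_eya]
  case f.false =>
    exact .inl ⟨1, one_mem _, true, 0, by simp, fun _ => by simp [stepRight]⟩
  case f.true =>
    exact .inl ⟨1, one_mem _, false, 0, by simp [aff_eq_a], fun _ => by simp [stepRight]⟩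
  all_goals exact .inr ⟨_, fun _ => rfl⟩

lemma a_mul_mem_aClass_or (w : WithOne S) (t : Bool) :
    γ a * γ f ^ t.toNat * w ∈ aClass ∨ ∃ s, ∀ h, runRight (live h t) w = s := by
  induction w using gen_induction generalizing t with
  | one => exact .inl ⟨1, one_mem _, t, by rw [mul_one, one_mul]⟩
  | gen_mul g w ih =>
    simp only [runRight_mul, runRight_gen]
    rcases a_mul_gen_mem_aClass_or g t with ⟨z, hz, t', k, hmul, hstep⟩ | ⟨s, hs⟩
    · simp only [hstep]
      refine (ih t').imp (fun hw => ?_) fun ⟨s, hs⟩ => ⟨s, fun h => hs (h + k)⟩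
      rw [← mul_assoc, hmul, mul_assoc z, mul_assoc z]
      exact mul_mem_aClass hz hw
    · exact .inr ⟨runRight s w, fun h => by rw [hs]⟩

lemma nonF_right_eq_zero_or (h : u = p * u * q) : nonF q = 0 ∨ u ∈ aClass := by
  suffices hfix : u ∈ aClass ∨ runRight (pend 0 0) (p * u) = runRight (pend 0 0) u by
    refine hfix.symm.imp_left fun hfix =>
      nonF_eq_zero_of_runRight_eq_self (countA_eq_zero_of_eq_mul_mul h).2
        (s := runRight (pend 0 0) u) ?_
    rw [← hfix, ← runRight_mul, ← h, hfix]
  rcases nonF_left_eq_zero_or h with hp | ⟨hp, z, hz, w, rfl⟩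
  · exact .inr (by rw [runRight_mul, runRight_pend_zero hp])
  rcases a_mul_mem_aClass_or w false with hw | ⟨s, hs⟩
  · refine .inl ?_
    rw [mul_assoc]
    refine mul_mem_aClass hz ?_
    simpa only [Bool.toNat_false, pow_zero, mul_one] using hw
  · obtain ⟨h₁, hrun₁⟩ := exists_runRight_mul_a (countA_eq_zero_of_mem_cexy hz) 0 0
    obtain ⟨h₂, hrun₂⟩ :=
      exists_runRight_mul_a (countA_eq_zero_of_mem_cexy (mul_mem hp hz)) 0 0
    refine .inr ?_
    rw [← mul_assoc, ← mul_assoc, runRight_mul, hrun₂, hs, runRight_mul, hrun₁, hs]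

end Dichotomies

section GreenRelations

variable {u v : S}

lemma greenL_of_mem_leftIdeal (hv : v ∈ leftIdeal u) (hu : u ∈ twoSidedIdeal v) :
    GreenL S u v := by
  have ⟨p', hv'⟩ := hv
  obtain ⟨p, q, hu⟩ := hu
  obtain ⟨s, hs⟩ : ∃ s, s * (p * p') * (u : WithOne S) = u :=
    exists_mul_mul_eq_self (q := q) (by rw [mul_assoc p, ← hv', ← hu])
  refine greenL_iff.2 ⟨⟨s * p, ?_⟩, hv⟩
  calc (u : WithOne S) = s * (p * p') * u := hs.symm
    _ = s * p * v := by rw [hv']; simp only [mul_assoc]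

lemma greenD_of_mem_aClass (hu : (u : WithOne S) ∈ aClass) (hv : (v : WithOne S) ∈ aClass) :
    GreenD S u v := by
  obtain ⟨z, hz, t, hu⟩ := hu
  obtain ⟨z', hz', t', hv⟩ := hv
  obtain ⟨r, -, hrz⟩ := exists_mul_mul_a_eq_a hz
  obtain ⟨r', -, hrz'⟩ := exists_mul_mul_a_eq_a hz'
  obtain ⟨m, hm⟩ := exists_coe_eq_mul (z' * r) u
  have hm' : (m : WithOne S) = z' * (γ a * γ f ^ t.toNat) := by
    rw [hm, hu]
    calc z' * r * (z * γ a * γ f ^ t.toNat) = z' * (r * z * γ a * γ f ^ t.toNat) := by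
          simp only [mul_assoc]
      _ = _ := by rw [hrz]
  refine ⟨m, greenL_iff.2 ⟨⟨z * r', ?_⟩, ⟨z' * r, hm⟩⟩,
    greenR_iff.2 ⟨⟨γ f ^ (t'.toNat + t.toNat), ?_⟩, ⟨γ f ^ (t.toNat + t'.toNat), ?_⟩⟩⟩
  · calc (u : WithOne S) = z * (r' * z' * γ a * γ f ^ t.toNat) := by
          rw [hrz', hu, mul_assoc]
      _ = z * r' * m := by rw [hm']; simp only [mul_assoc]
  · rw [hm', hv, mul_assoc z', mul_assoc z', a_mul_f_pow_mul_f_pow_add]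
  · rw [hm', hv, mul_assoc z', mul_assoc z', a_mul_f_pow_mul_f_pow_add]

lemma greenD_of_mem_rightIdeal (hv : v ∈ rightIdeal u) (hu : u ∈ twoSidedIdeal v) :
    GreenD S u v := by
  have ⟨q', hv'⟩ := hv
  obtain ⟨p, q, hu⟩ := hu
  have hu' : (u : WithOne S) = p * u * (q' * q) := by
    calc (u : WithOne S) = p * v * q := hu
      _ = p * u * (q' * q) := by rw [hv']; simp only [mul_assoc]
  have hv'' : (v : WithOne S) = p * v * (q * q') := by
    calc (v : WithOne S) = p * v * q * q' := by rw [← hu, hv']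
      _ = p * v * (q * q') := mul_assoc _ _ _
  by_cases hq : nonF (q' * q) = 0
  · refine GreenR.greenD (greenR_iff.2 ⟨⟨q * (q' * q), ?_⟩, hv⟩)
    calc (u : WithOne S) = p * u * (q' * q) := hu'
      _ = p * u * (q' * q * (q' * q) * (q' * q)) := by
        rw [mul_mul_eq_self_of_nonF_eq_zero hq]
      _ = p * u * (q' * q) * (q' * q * (q' * q)) := by simp only [mul_assoc]
      _ = v * (q * (q' * q)) := by rw [← hu', hv']; simp only [mul_assoc]
  · have hq' : nonF (q * q') ≠ 0 := by rwa [nonF_mul, add_comm, ← nonF_mul]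
    exact greenD_of_mem_aClass ((nonF_right_eq_zero_or hu').resolve_left hq)
      ((nonF_right_eq_zero_or hv'').resolve_left hq')

lemma greenJ_eq_greenD : GreenJ S = GreenD S :=
  greenJ_eq_greenD_of_one_sided (fun _ _ => greenL_of_mem_leftIdeal)
    fun _ _ => greenD_of_mem_rightIdeal

end GreenRelations

section ComplementOfF

open State

lemma f_ne_f_mul_f : γ f ≠ γ f * γ f := by
  intro h
  simpa [stepRight] using congrArg (runRight (live 0 false)) h

lemma ne_gen_f_of_nonF_ne_zero {u : S} (hu : nonF u ≠ 0) : u ≠ gen f := by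
  rintro rfl
  exact hu rfl

lemma eq_f_mul_f_of_nonF_eq_zero {u : S} (hu : nonF u = 0) (huf : u ≠ gen f) :
    (u : WithOne S) = γ f * γ f := by
  rcases eq_f_pow_of_nonF_eq_zero hu with h | h | h
  · exact absurd h WithOne.coe_ne_one
  · exact absurd (WithOne.coe_injective h) huf
  · exact h

lemma mul_ne_gen_f {u v : S} (hu : u ≠ gen f) (hv : v ≠ gen f) : u * v ≠ gen f := by
  intro h
  have hmul : (u : WithOne S) * v = γ f := congrArg _ h
  obtain ⟨hu₀, hv₀⟩ : nonF u = 0 ∧ nonF v = 0 := by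
    rw [← add_eq_zero, ← nonF_mul, hmul]
    rfl
  rw [eq_f_mul_f_of_nonF_eq_zero hu₀ hu, eq_f_mul_f_of_nonF_eq_zero hv₀ hv, ← mul_assoc,
    fff_eq_f] at hmul
  exact f_ne_f_mul_f hmul.symm

/-- The subsemigroup `S ∖ {f}` of `S`. -/
def complF : Subsemigroup S where
  carrier := {gen f}ᶜ
  mul_mem' := mul_ne_gen_f

/-- The embedding of `(S ∖ {f})¹` into `S¹`. -/
def inclusion : WithOne complF →* WithOne S :=
  WithOne.mapMulHom (MulMemClass.subtype complF)

lemma inclusion_ne_f (p : WithOne complF) : inclusion p ≠ γ f := by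
  cases p with
  | one => exact WithOne.one_ne_coe
  | coe u => exact fun h => u.2 (WithOne.coe_injective h)

lemma isLarge_complF : IsLarge complF := by
  change ({gen f}ᶜᶜ : Set S).Finite
  rw [compl_compl]
  exact Set.finite_singleton _

lemma gen_mem_complF {g : Gen} (hg : g ≠ f) : gen g ∈ complF :=
  ne_gen_f_of_nonF_ne_zero (by
    rw [nonF_gen, if_neg hg]
    split_ifs <;> simp)

lemma af_mem_complF : gen a * gen f ∈ complF :=
  ne_gen_f_of_nonF_ne_zero (by simp)

lemma greenJ_a_af :
    GreenJ complF ⟨gen a, gen_mem_complF (by decide)⟩ ⟨gen a * gen f, af_mem_complF⟩ := by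
  let ι (g : Gen) (hg : g ≠ f) : complF := ⟨gen g, gen_mem_complF hg⟩
  refine greenJ_iff.2 ⟨?_, ?_⟩
  · convert mul_mul_mem_twoSidedIdeal (ι c (by decide) * ι x (by decide)) _ (ι d (by decide))
    exact WithOne.coe_injective cxafd_eq_a.symm
  · convert mul_mul_mem_twoSidedIdeal (ι y (by decide)) _ (ι b (by decide))
    exact WithOne.coe_injective af_eq_yab

lemma eq_f_of_a_mul_f_eq {m p q r : WithOne S} (hp : m = p * γ a) (hq : m = γ a * γ f * q)
    (hr : γ a * γ f = m * r) : r = γ f := by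
  obtain ⟨hp₀, hq₀, hr₀⟩ : countA p = 0 ∧ countA q = 0 ∧ countA r = 0 := by
    have h₁ := congrArg countA (hp.symm.trans hq)
    have h₂ := congrArg countA (hp ▸ hr)
    simp only [countA_mul, countA_gen, if_true, reduceCtorEq, if_false] at h₁ h₂
    omega
  obtain ⟨l, hl⟩ := exists_nonF_eq_natCast hq₀
  obtain ⟨n, hn⟩ := exists_nonF_eq_natCast hr₀
  obtain ⟨h, hm⟩ : ∃ h, runRight (pend 0 0) m = live h false :=
    hp ▸ exists_runRight_mul_a hp₀ 0 0
  have hlive : runRight (pend 0 0) (γ a * γ f) = live 0 true := rfl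
  have hqrun : runRight (live 0 true) q = live h false := by
    rw [← hlive, ← runRight_mul, ← hq, hm]
  have hrrun : runRight (live h false) r = live 0 true := by
    rw [← hm, ← runRight_mul, ← hr, hlive]
  have h_eq : h = 0 + l := potential_eq_of_runRight_live hl hqrun
  have zero_eq : 0 = h + n := potential_eq_of_runRight_live hn hrrun
  obtain rfl : n = 0 := by omega
  rcases eq_f_pow_of_nonF_eq_zero hn with rfl | rfl | rfl
  · simp at hrrun
  · rfl
  · simp [stepRight] at hrrun

lemma not_greenD_a_af :
    ¬ GreenD complF ⟨gen a, gen_mem_complF (by decide)⟩ ⟨gen a * gen f, af_mem_complF⟩ := by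
  rintro ⟨m, hL, hR⟩
  obtain ⟨-, p, hp⟩ := greenL_iff.1 hL
  obtain ⟨⟨q, hq⟩, r, hr⟩ := greenR_iff.1 hR
  refine inclusion_ne_f r (eq_f_of_a_mul_f_eq (m := inclusion m) (p := inclusion p)
    (q := inclusion q) ?_ ?_ ?_)
  · rw [hp, map_mul]
    rfl
  · rw [hq, map_mul]
    rfl
  · rw [← map_mul, ← hr]
    rfl

end ComplementOfF

end SemigroupExample

theorem mainTheorem5 :
    ∃ T : Subsemigroup SemigroupExample.S,
      (T : Set SemigroupExample.S) = {SemigroupExample.gen SemigroupExample.Gen.f}ᶜ ∧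
      SemigroupExample.IsLarge T ∧
      SemigroupExample.GreenJ SemigroupExample.S = SemigroupExample.GreenD SemigroupExample.S ∧
      SemigroupExample.GreenJ T ≠ SemigroupExample.GreenD T := by
  refine ⟨SemigroupExample.complF, rfl, SemigroupExample.isLarge_complF,
    SemigroupExample.greenJ_eq_greenD, fun h => ?_⟩
  exact SemigroupExample.not_greenD_a_af (h ▸ SemigroupExample.greenJ_a_af)
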